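/- Let $X$ be a real Banach space that is a dual space, or more generally is linearly homeomorphic to the dual $M^*$ of some real normed space $M$. Then $X$ is separably injective if and only if it is universally left-stable. Moreover, the following four properties of $X$ are equivalent: 1. $X$ is cardinality injective: for every real normed space $Y$ (not necessarily complete) of the same cardinality as $X$ and every linear isometric embedding $j\colon X\to Y$, the subspace $j(X)$ is the range of a bounded linear projection on $Y$. 2. $X$ is separably injective: there is $\lambda\ge 1$ such that for every separable real Banach space $E$ and every closed subspace $F\subseteq E$, each bounded linear operator $T\colon F\to X$ has a bounded linear extension $S\colon E\to X$ with $\|S\|\le\lambda\|T\|$. 3. $X$ is injective: there is $\lambda\ge 1$ such that the extension property in 2 holds for all real Banach spaces $E$, separable or not, and all closed subspaces $F\subseteq E$. 4. $X$ is universally left-stable: for every real Banach space $Y$, every $\varepsilon\ge 0$ and every map $f\colon X\to Y$ with $f(0)=0$ and $\bigl|\,\|f(x)-f(y)\|-\|x-y\|\,\bigr|\le\varepsilon$ for all $x,y\in X$, there are $\alpha,\gamma>0$ and a bounded linear operator $T\colon L(f)\to X$ with $\|T\|\le\alpha$ and $\|Tf(x)-x\|\le\gamma\varepsilon$ for all $x\in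 X$, where $L(f)$ is the closed linear span of $f(X)$ in $Y$. -/

import Mathlib

universe u v

namespace StableEmbedding

section Stability

variable {X Y : Type*} [NormedAddCommGroup X] [NormedSpace ℝ X]
  [NormedAddCommGroup Y] [NormedSpace ℝ Y]

/-- `f` is an `ε`-isometry: it distorts distances by at most `ε` (additively).
No linearity or continuity is assumed. -/
def IsEpsIsometry (ε : ℝ) (f : X → Y) : Prop :=
  ∀ x y : X, |‖f x - f y‖ - ‖x - y‖| ≤ ε

/-- A standard `ε`-isometry is an `ε`-isometry that maps `0` to `0`. -/
def IsStandardEpsIsometry (ε : ℝ) (f : X → Y) : Prop :=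
  IsEpsIsometry ε f ∧ f 0 = 0

/-- `L(f)`: the closed linear span of the range of `f`. -/
def closedSpanRange (f : X → Y) : Submodule ℝ Y :=
  (Submodule.span ℝ (Set.range f)).topologicalClosure

theorem mem_closedSpanRange (f : X → Y) (x : X) : f x ∈ closedSpanRange f :=
  Submodule.le_topologicalClosure _ (Submodule.subset_span (Set.mem_range_self x))

/-- A standard `ε`-isometry `f` is `(α, γ)`-stable if there is a bounded linear operator
`T : L(f) → X` with `‖T‖ ≤ α` and `‖T (f x) - x‖ ≤ γ ε` for all `x`. -/
def IsStableMap (α γ ε : ℝ) (f : X → Y) : Prop :=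
  ∃ T : closedSpanRange f →L[ℝ] X, ‖T‖ ≤ α ∧
    ∀ x : X, ‖T ⟨f x, mem_closedSpanRange f x⟩ - x‖ ≤ γ * ε

variable (X Y) in
/-- The pair `(X, Y)` is stable: for every `ε ≥ 0`, every standard `ε`-isometry `X → Y` is
`(α, γ)`-stable for some `α, γ > 0` (which may depend on the map). -/
def IsStablePair : Prop :=
  ∀ ε : ℝ, 0 ≤ ε → ∀ f : X → Y, IsStandardEpsIsometry ε f →
    ∃ α γ : ℝ, 0 < α ∧ 0 < γ ∧ IsStableMap α γ ε f

end Stability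

section Classes

variable (X : Type u) [NormedAddCommGroup X] [NormedSpace ℝ X]

/-- `X` is universally left-stable: `(X, Y)` is stable for every Banach space `Y`.
(Only `L(f)` matters; it has density character at most the cardinality of `ℕ × X`, so Banach
spaces in the universe of `X` represent all of them.) -/
def IsUniversallyLeftStable : Prop :=
  ∀ (Y : Type u) [NormedAddCommGroup Y] [NormedSpace ℝ Y] [CompleteSpace Y], IsStablePair X Y

/-- `X` is `lam`-injective: every bounded operator `T` from a closed subspace `F` of a Banach
space `E` into `X` extends to an operator on `E` of norm at most `lam * ‖T‖`. -/
def IsInjectiveWith (lam : ℝ) : Prop :=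
  ∀ (E : Type u) [NormedAddCommGroup E] [NormedSpace ℝ E] [CompleteSpace E]
    (F : Submodule ℝ E), IsClosed (F : Set E) → ∀ T : F →L[ℝ] X,
      ∃ S : E →L[ℝ] X, (∀ z : F, S z = T z) ∧ ‖S‖ ≤ lam * ‖T‖

/-- `X` is injective: `lam`-injective for some `lam ≥ 1`. -/
def IsInjectiveSpace : Prop :=
  ∃ lam : ℝ, 1 ≤ lam ∧ IsInjectiveWith X lam

/-- `X` is `lam`-separably injective: the extension property for closed subspaces of separable
Banach spaces. -/
def IsSeparablyInjectiveWith (lam : ℝ) : Prop :=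
  ∀ (E : Type u) [NormedAddCommGroup E] [NormedSpace ℝ E] [CompleteSpace E]
    [TopologicalSpace.SeparableSpace E]
    (F : Submodule ℝ E), IsClosed (F : Set E) → ∀ T : F →L[ℝ] X,
      ∃ S : E →L[ℝ] X, (∀ z : F, S z = T z) ∧ ‖S‖ ≤ lam * ‖T‖

/-- `X` is separably injective: `lam`-separably injective for some `lam ≥ 1`. -/
def IsSeparablyInjective : Prop :=
  ∃ lam : ℝ, 1 ≤ lam ∧ IsSeparablyInjectiveWith X lam

/-- `X` is cardinality injective: it is complemented (as the range of a bounded linear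
projection) in every normed space of the same cardinality that contains `X` isometrically.
The superspace need not be complete. -/
def IsCardinalityInjective : Prop :=
  ∀ (Y : Type u) [NormedAddCommGroup Y] [NormedSpace ℝ Y] (j : X →ₗᵢ[ℝ] Y),
    Cardinal.mk Y = Cardinal.mk X → (LinearMap.range j.toLinearMap).ClosedComplemented

end Classes

end StableEmbedding

/-! The engine is weak-star compactness: uniformly bounded operators into a space isomorphic to a
dual, each defined on a piece of a directed family, have an ultrafilter limit
(`exists_clm_ultrafilter_limit`). Embed `X` isometrically in an `ℓ∞` space, itself injective by
coordinatewise Hahn–Banach. If the inverse of the embedding extends to finite-dimensional subspaces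
with uniform bounds, the limit is a retraction and `X` is injective. Separable or cardinality
injectivity supplies these local extensions.

Injectivity gives left-stability because, on a finite-dimensional subspace, derivatives of the norm
are norming and an `ε`-isometry carries each to a functional with error `4ε`; injectivity turns
these into an approximate left inverse, and a limit over subspaces finishes. Conversely, if `Y ⊇ X`
has the cardinality of `X`, perturbing the inclusion by a map of `X` onto the unit ball of `Y` makes
`L(f)` contain `Y`, and the stability operator is a projection. -/

namespace StableEmbedding

open Filter Topology Metric
open scoped ENNReal

/-! ### Weak-star limits along ultrafilters -/

section Limits

/-- A limit along an ultrafilter of pointwise bounded, eventually linear scalar functions. -/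
theorem exists_strongDual_tendsto {ι Z : Type*} [NormedAddCommGroup Z] [NormedSpace ℝ Z]
    (U : Ultrafilter ι) (s : ι → Z → ℝ) {C : ℝ} (hC : 0 ≤ C)
    (hb : ∀ z, ∀ᶠ i in U, |s i z| ≤ C * ‖z‖)
    (hadd : ∀ z w, ∀ᶠ i in U, s i (z + w) = s i z + s i w)
    (hsmul : ∀ (c : ℝ) z, ∀ᶠ i in U, s i (c • z) = c * s i z) :
    ∃ S : StrongDual ℝ Z, ‖S‖ ≤ C ∧ ∀ z, Tendsto (fun i => s i z) U (𝓝 (S z)) := by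
  have hlim : ∀ z, ∃ a, Tendsto (fun i => s i z) U (𝓝 a) := fun z => by
    obtain ⟨a, -, ha⟩ := (isCompact_Icc (a := -(C * ‖z‖)) (b := C * ‖z‖)).ultrafilter_le_nhds
      (U.map fun i => s i z) (by
        rw [le_principal_iff]
        exact (hb z).mono fun i hi => abs_le.1 hi)
    exact ⟨a, ha⟩
  choose L hL using hlim
  let S₀ : Z →ₗ[ℝ] ℝ :=
    { toFun := L
      map_add' := fun z w => tendsto_nhds_unique (hL (z + w))
        (((hL z).add (hL w)).congr' ((hadd z w).mono fun i hi => hi.symm))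
      map_smul' := fun c z => tendsto_nhds_unique (hL (c • z))
        (((hL z).const_mul c).congr' ((hsmul c z).mono fun i hi => hi.symm)) }
  have hS : ∀ z, ‖S₀ z‖ ≤ C * ‖z‖ := fun z => le_of_tendsto (hL z).norm (hb z)
  exact ⟨S₀.mkContinuous C hS, S₀.mkContinuous_norm_le hC hS, hL⟩

/-- A weak-star limit along an ultrafilter of bounded, eventually linear maps into a space that is
isomorphic to a dual space. -/
theorem exists_clm_ultrafilter_limit {ι Z X M : Type*}
    [NormedAddCommGroup Z] [NormedSpace ℝ Z] [NormedAddCommGroup X] [NormedSpace ℝ X]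
    [NormedAddCommGroup M] [NormedSpace ℝ M] (e : X ≃L[ℝ] StrongDual ℝ M)
    (U : Ultrafilter ι) (s : ι → Z → X) {C : ℝ} (hC : 0 ≤ C)
    (hb : ∀ z, ∀ᶠ i in U, ‖s i z‖ ≤ C * ‖z‖)
    (hadd : ∀ z w, ∀ᶠ i in U, s i (z + w) = s i z + s i w)
    (hsmul : ∀ (c : ℝ) z, ∀ᶠ i in U, s i (c • z) = c • s i z) :
    ∃ S : Z →L[ℝ] X, ∀ z a c, 0 ≤ c → (∀ᶠ i in U, ‖s i z - a‖ ≤ c) →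
      ‖S z - a‖ ≤ ‖(e.symm : StrongDual ℝ M →L[ℝ] X)‖ * (‖(e : X →L[ℝ] StrongDual ℝ M)‖ * c) := by
  set K := ‖(e : X →L[ℝ] StrongDual ℝ M)‖
  have he : ∀ (x : X) (m : M), |e x m| ≤ K * ‖x‖ * ‖m‖ := fun x m =>
    ((e x).le_opNorm m).trans (mul_le_mul_of_nonneg_right
      ((e : X →L[ℝ] StrongDual ℝ M).le_opNorm x) (norm_nonneg m))
  have hlim : ∀ z, ∃ L : StrongDual ℝ M, ‖L‖ ≤ K * (C * ‖z‖) ∧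
      ∀ m, Tendsto (fun i => e (s i z) m) U (𝓝 (L m)) := fun z => by
    refine exists_strongDual_tendsto U (fun i m => e (s i z) m) (by positivity) (fun m => ?_)
      (fun m m' => Eventually.of_forall fun i => map_add _ _ _)
      (fun c m => Eventually.of_forall fun i => by simp)
    refine (hb z).mono fun i hi => (he _ _).trans ?_
    gcongr
  choose L hLn hL using hlim
  let S₀ : Z →ₗ[ℝ] StrongDual ℝ M :=
    { toFun := L
      map_add' := fun z w => by
        ext m
        refine tendsto_nhds_unique (hL (z + w) m)
          (((hL z m).add (hL w m)).congr' ((hadd z w).mono fun i hi => ?_))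
        simp [hi]
      map_smul' := fun c z => by
        ext m
        refine tendsto_nhds_unique (hL (c • z) m)
          (((hL z m).const_mul c).congr' ((hsmul c z).mono fun i hi => ?_))
        simp [hi] }
  let S₁ : Z →L[ℝ] StrongDual ℝ M := S₀.mkContinuous (K * C) fun z => by
    rw [mul_assoc]; exact hLn z
  refine ⟨(e.symm : StrongDual ℝ M →L[ℝ] X).comp S₁, fun z a c hc h => ?_⟩
  -- The dual norm is weak-star lower semicontinuous, so only the passages through `e` and `e.symm`
  -- cost constants.
  have h1 : ‖L z - e a‖ ≤ K * c := by
    refine ContinuousLinearMap.opNorm_le_bound _ (by positivity) fun m => ?_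
    refine le_of_tendsto ((hL z m).sub_const (e a m)).norm (h.mono fun i hi => ?_)
    have : e (s i z) m - e a m = e (s i z - a) m := by simp
    rw [this]
    refine (he _ _).trans ?_
    gcongr
  have h2 : (e.symm : StrongDual ℝ M →L[ℝ] X).comp S₁ z - a
      = (e.symm : StrongDual ℝ M →L[ℝ] X) (L z - e a) := by
    simp [S₁, S₀]
  rw [h2]
  exact (ContinuousLinearMap.le_opNorm _ _).trans (by gcongr)

end Limits

/-! ### Spaces of bounded families -/

section SupNorm

/-- A bounded family of functionals gives an operator into a space of bounded families. -/
theorem exists_clm_lp_infty {Γ E : Type*} [NormedAddCommGroup E] [NormedSpace ℝ E]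
    (φ : Γ → StrongDual ℝ E) {C : ℝ} (hC : 0 ≤ C) (hφ : ∀ γ, ‖φ γ‖ ≤ C) :
    ∃ Φ : E →L[ℝ] lp (fun _ : Γ => ℝ) ∞, ‖Φ‖ ≤ C ∧ ∀ x γ, Φ x γ = φ γ x := by
  have hb : ∀ x γ, ‖φ γ x‖ ≤ C * ‖x‖ := fun x γ =>
    ((φ γ).le_opNorm x).trans (mul_le_mul_of_nonneg_right (hφ γ) (norm_nonneg x))
  let Φ₀ : E →ₗ[ℝ] lp (fun _ : Γ => ℝ) ∞ :=
    { toFun := fun x => ⟨fun γ => φ γ x, memℓp_infty ⟨C * ‖x‖, by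
        rintro _ ⟨γ, rfl⟩
        exact hb x γ⟩⟩
      map_add' := fun x y => by ext γ; exact map_add _ _ _
      map_smul' := fun c x => by ext γ; exact map_smul _ _ _ }
  have hΦ : ∀ x, ‖Φ₀ x‖ ≤ C * ‖x‖ := fun x =>
    lp.norm_le_of_forall_le (by positivity) (hb x)
  exact ⟨Φ₀.mkContinuous C hΦ, Φ₀.mkContinuous_norm_le hC hΦ, fun _ _ => rfl⟩

/-- Hahn–Banach extension for operators into a space of bounded families. -/
theorem exists_extension_lp_infty {Γ E : Type*} [NormedAddCommGroup E] [NormedSpace ℝ E]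
    (F : Submodule ℝ E) (T : F →L[ℝ] lp (fun _ : Γ => ℝ) ∞) :
    ∃ S : E →L[ℝ] lp (fun _ : Γ => ℝ) ∞, (∀ z : F, S z = T z) ∧ ‖S‖ ≤ ‖T‖ := by
  have hb : ∀ (γ : Γ) (z : F), ‖T z γ‖ ≤ ‖T‖ * ‖z‖ := fun γ z =>
    (lp.norm_apply_le_norm ENNReal.top_ne_zero (T z) γ).trans (T.le_opNorm z)
  let t : Γ → StrongDual ℝ F := fun γ => LinearMap.mkContinuous
    { toFun := fun z => T z γ
      map_add' := fun z w => by simp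
      map_smul' := fun c z => by simp } ‖T‖ (hb γ)
  choose g hg hgn using fun γ => exists_extension_norm_eq F (t γ)
  obtain ⟨S, hSn, hS⟩ := exists_clm_lp_infty g (norm_nonneg T) fun γ => by
    rw [hgn]; exact LinearMap.mkContinuous_norm_le _ (norm_nonneg T) (hb γ)
  refine ⟨S, fun z => ?_, hSn⟩
  ext γ
  rw [hS, hg]
  rfl

/-- Every normed space embeds isometrically into the bounded families over its dual ball. -/
theorem exists_linearIsometry_lp_infty (X : Type*) [NormedAddCommGroup X] [NormedSpace ℝ X] :
    ∃ j : X →ₗᵢ[ℝ] lp (fun _ : closedBall (0 : StrongDual ℝ X) 1 => ℝ) ∞,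
      ∀ x γ, j x γ = γ.1 x := by
  obtain ⟨Φ, hn, hΦ⟩ := exists_clm_lp_infty
    (fun γ : closedBall (0 : StrongDual ℝ X) 1 => γ.1) zero_le_one
    (fun γ => mem_closedBall_zero_iff.1 γ.2)
  refine ⟨⟨Φ.toLinearMap, fun x => le_antisymm ?_ ?_⟩, hΦ⟩
  · simpa using Φ.le_of_opNorm_le hn x
  · obtain ⟨g, hg, hgx⟩ := exists_dual_vector'' ℝ x
    have := lp.norm_apply_le_norm ENNReal.top_ne_zero (Φ x) ⟨g, by simpa using hg⟩
    rw [hΦ] at this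
    simpa [hgx] using this

end SupNorm

/-! ### From local complementation to injectivity -/

section Extension

variable {X : Type u} [NormedAddCommGroup X] [NormedSpace ℝ X]

/-- Extension along an isometric embedding into an arbitrary superspace. -/
theorem IsInjectiveWith.exists_comp_eq {lam : ℝ} (h : IsInjectiveWith X lam) (hlam : 0 ≤ lam)
    {G : Type*} {Z : Type u} [NormedAddCommGroup G] [NormedSpace ℝ G] [CompleteSpace G]
    [NormedAddCommGroup Z] [NormedSpace ℝ Z] [CompleteSpace Z] (J : G →ₗᵢ[ℝ] Z) (A : G →L[ℝ] X) :
    ∃ S : Z →L[ℝ] X, (∀ g, S (J g) = A g) ∧ ‖S‖ ≤ lam * ‖A‖ := by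
  let i : G ≃ₗᵢ[ℝ] LinearMap.range J.toLinearMap := J.equivRange
  obtain ⟨S, hS, hn⟩ := h Z (LinearMap.range J.toLinearMap)
    (by
      rw [LinearMap.coe_range]
      exact J.isometry.isClosedEmbedding.isClosed_range)
    (A.comp (i.symm.toContinuousLinearEquiv : LinearMap.range J.toLinearMap →L[ℝ] G))
  refine ⟨S, fun g => ?_, hn.trans ?_⟩
  · exact (hS (i g)).trans (congrArg A (i.symm_apply_apply g))
  · refine mul_le_mul_of_nonneg_left (ContinuousLinearMap.opNorm_le_bound _ (norm_nonneg _)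
      fun z => ?_) hlam
    simpa using A.le_opNorm (i.symm z)

/-- A complemented subspace of a space of bounded families is injective. -/
theorem isInjectiveSpace_of_retract {Γ : Type*} (j : X →ₗᵢ[ℝ] lp (fun _ : Γ => ℝ) ∞)
    (P : lp (fun _ : Γ => ℝ) ∞ →L[ℝ] X) (hP : ∀ x, P (j x) = x) : IsInjectiveSpace X := by
  refine ⟨max 1 ‖P‖, le_max_left _ _, fun E _ _ _ F _ T => ?_⟩
  obtain ⟨S, hS, hn⟩ := exists_extension_lp_infty F (j.toContinuousLinearMap.comp T)
  refine ⟨P.comp S, fun z => by simp [hS, hP], (P.opNorm_comp_le S).trans ?_⟩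
  refine mul_le_mul (le_max_right _ _) (hn.trans ?_) (norm_nonneg _) (by positivity)
  exact ContinuousLinearMap.opNorm_le_bound _ (norm_nonneg T) fun z => by simpa using T.le_opNorm z

/-- The range of `j` is complemented locally: the partial inverse of `j` on the span of each
finite set extends to that span, with a uniform bound for the norms. -/
def IsLocallyComplemented {Z : Type*} [NormedAddCommGroup Z] [NormedSpace ℝ Z]
    (j : X →ₗᵢ[ℝ] Z) : Prop :=
  ∃ C : ℝ, 0 ≤ C ∧ ∀ s : Finset Z, ∃ S : Submodule.span ℝ (s : Set Z) →L[ℝ] X,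
    ‖S‖ ≤ C ∧ ∀ x (h : j x ∈ Submodule.span ℝ (s : Set Z)), S ⟨j x, h⟩ = x

theorem IsLocallyComplemented.exists_retraction {Z M : Type*} [NormedAddCommGroup Z]
    [NormedSpace ℝ Z] [NormedAddCommGroup M] [NormedSpace ℝ M] (e : X ≃L[ℝ] StrongDual ℝ M)
    {j : X →ₗᵢ[ℝ] Z} (h : IsLocallyComplemented j) :
    ∃ P : Z →L[ℝ] X, ∀ x, P (j x) = x := by
  classical
  obtain ⟨C, hC, h⟩ := h
  choose S hSn hS using h
  let U : Ultrafilter (Finset Z) := Ultrafilter.of atTop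
  have hU : (U : Filter (Finset Z)) ≤ atTop := Ultrafilter.of_le _
  have hmem : ∀ z : Z, ∀ᶠ t : Finset Z in U, z ∈ Submodule.span ℝ (t : Set Z) := fun z => by
    refine hU ((eventually_ge_atTop {z}).mono fun t ht => Submodule.subset_span ?_)
    exact ht (Finset.mem_singleton_self z)
  -- The value `0` off the span is harmless: each vector lies in all large spans, so linearity holds
  -- eventually.
  let s : Finset Z → Z → X := fun t z =>
    if hz : z ∈ Submodule.span ℝ (t : Set Z) then S t ⟨z, hz⟩ else 0
  obtain ⟨P, hP⟩ := exists_clm_ultrafilter_limit e U s hC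
    (fun z => (hmem z).mono fun t hz => by
      simp only [s, dif_pos hz]
      exact (S t).le_of_opNorm_le (hSn t) ⟨z, hz⟩)
    (fun z w => ((hmem z).and (hmem w)).mono fun t ⟨hz, hw⟩ => by
      simp only [s, dif_pos hz, dif_pos hw, dif_pos (add_mem hz hw)]
      rw [← map_add]; rfl)
    (fun c z => (hmem z).mono fun t hz => by
      simp only [s, dif_pos hz, dif_pos (Submodule.smul_mem _ c hz)]
      rw [← map_smul]; rfl)
  refine ⟨P, fun x => ?_⟩
  have := hP (j x) x 0 le_rfl ((hmem (j x)).mono fun t hx => by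
    simp only [s, dif_pos hx, hS, sub_self, norm_zero, le_refl])
  rw [mul_zero, mul_zero] at this
  exact sub_eq_zero.1 (norm_le_zero_iff.1 this)

/-- Finite-dimensional spans are separable Banach spaces, and the partial inverse of `j` has norm at
most 1. -/
theorem IsSeparablyInjective.isLocallyComplemented (h : IsSeparablyInjective X) {Z : Type u}
    [NormedAddCommGroup Z] [NormedSpace ℝ Z] (j : X →ₗᵢ[ℝ] Z) : IsLocallyComplemented j := by
  obtain ⟨lam, hlam, h⟩ := h
  refine ⟨lam, zero_le_one.trans hlam, fun s => ?_⟩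
  set G := Submodule.span ℝ (s : Set Z)
  have : FiniteDimensional ℝ G := FiniteDimensional.span_finset ℝ s
  have : CompleteSpace G := FiniteDimensional.complete ℝ G
  have : ProperSpace G := FiniteDimensional.proper_real G
  let F : Submodule ℝ G := (LinearMap.range j.toLinearMap).comap G.subtype
  let i : X ≃ₗᵢ[ℝ] LinearMap.range j.toLinearMap := j.equivRange
  let T : F →ₗ[ℝ] X := i.symm.toLinearEquiv.toLinearMap.comp
    ((G.subtype.comp F.subtype).codRestrict (LinearMap.range j.toLinearMap) fun z => z.2)
  have hT : ∀ z, ‖T z‖ ≤ 1 * ‖z‖ := fun z => by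
    rw [one_mul]
    exact (i.symm.norm_map _).le
  obtain ⟨S, hS, hn⟩ := h G F F.closed_of_finiteDimensional (T.mkContinuous 1 hT)
  refine ⟨S, hn.trans ?_, fun x hx => ?_⟩
  · exact mul_le_of_le_one_right (zero_le_one.trans hlam) (T.mkContinuous_norm_le zero_le_one hT)
  · refine (hS ⟨⟨j x, hx⟩, x, rfl⟩).trans ?_
    exact i.symm_apply_apply x

theorem mk_prod_finsupp [Nontrivial X] : Cardinal.mk (X × (ℕ →₀ ℝ)) = Cardinal.mk X := by
  have hX := continuum_le_cardinal_of_module ℝ X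
  rw [Cardinal.mk_prod, Cardinal.mk_finsupp_lift_of_infinite]
  simp only [Cardinal.lift_id, Cardinal.mk_real, Cardinal.mk_nat,
    max_eq_right Cardinal.aleph0_le_continuum, Cardinal.lift_uzero, Cardinal.lift_continuum]
  exact Cardinal.mul_eq_left (Cardinal.aleph0_le_continuum.trans hX) hX
    Cardinal.continuum_ne_zero

/-- If no uniform bound existed, countably many bad finite sets could be adjoined to `j(X)` without
raising its cardinality; one projection would then bound them all. -/
theorem IsCardinalityInjective.isLocallyComplemented (h : IsCardinalityInjective X) {Z : Type u}
    [NormedAddCommGroup Z] [NormedSpace ℝ Z] (j : X →ₗᵢ[ℝ] Z) : IsLocallyComplemented j := by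
  rcases subsingleton_or_nontrivial X with hX | hX
  · exact ⟨0, le_rfl, fun s => ⟨0, ContinuousLinearMap.opNorm_zero.le, fun x hx => Subsingleton.elim _ _⟩⟩
  by_contra hcon
  have hbad : ∀ n : ℕ, ∃ s : Finset Z, ∀ S : Submodule.span ℝ (s : Set Z) →L[ℝ] X,
      (∀ x (h : j x ∈ Submodule.span ℝ (s : Set Z)), S ⟨j x, h⟩ = x) → (n : ℝ) < ‖S‖ := by
    intro n
    by_contra! hn
    refine hcon ⟨n, n.cast_nonneg, fun s => ?_⟩
    obtain ⟨S, hS, hSn⟩ := hn s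
    exact ⟨S, hSn, hS⟩
  choose s hs using hbad
  obtain ⟨v, hv⟩ : ∃ v : ℕ → Z, insert 0 (⋃ n, (s n : Set Z)) = Set.range v :=
    ((Set.countable_iUnion fun n => (s n).countable_toSet).insert 0).exists_eq_range
      (Set.insert_nonempty _ _)
  let B : X × (ℕ →₀ ℝ) →ₗ[ℝ] Z := j.toLinearMap.coprod (Finsupp.linearCombination ℝ v)
  let Y : Submodule ℝ Z := LinearMap.range B
  have hjY : ∀ x, j x ∈ Y := fun x => ⟨(x, 0), by simp [B]⟩
  have hGY : ∀ n, Submodule.span ℝ (s n : Set Z) ≤ Y := fun n => by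
    rw [Submodule.span_le]
    intro z hz
    obtain ⟨k, rfl⟩ : z ∈ Set.range v := hv ▸ Or.inr (Set.mem_iUnion.2 ⟨n, hz⟩)
    exact ⟨(0, Finsupp.single k 1), by simp [B]⟩
  let jY : X →ₗᵢ[ℝ] Y := ⟨j.toLinearMap.codRestrict Y hjY, fun x => j.norm_map x⟩
  have hcard : Cardinal.mk Y = Cardinal.mk X := by
    apply le_antisymm
    · rw [← mk_prod_finsupp (X := X)]
      exact Cardinal.mk_le_of_surjective B.surjective_rangeRestrict
    · exact Cardinal.mk_le_of_injective jY.injective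
  obtain ⟨p, hp⟩ := h Y jY hcard
  let i : X ≃ₗᵢ[ℝ] LinearMap.range jY.toLinearMap := jY.equivRange
  let P : Y →L[ℝ] X :=
    (i.symm.toContinuousLinearEquiv : LinearMap.range jY.toLinearMap →L[ℝ] X).comp p
  have hP : ∀ x, P (jY x) = x := fun x => by
    have h1 : p (jY x) = i x := hp (i x)
    simp [P, h1]
  obtain ⟨n, hn⟩ := exists_nat_ge ‖P‖
  let I : Submodule.span ℝ (s n : Set Z) →ₗ[ℝ] Y := Submodule.inclusion (hGY n)
  have hI : ∀ z, ‖P (I z)‖ ≤ ‖P‖ * ‖z‖ := fun z => P.le_opNorm (I z)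
  refine (hs n ((P.toLinearMap.comp I).mkContinuous ‖P‖ hI) fun x hx => hP x).not_ge ?_
  exact ((P.toLinearMap.comp I).mkContinuous_norm_le (norm_nonneg P) hI).trans hn

end Extension

/-! ### Left-stability and `ε`-isometries -/

section LeftStability

variable {X : Type u} [NormedAddCommGroup X] [NormedSpace ℝ X]

theorem tendsto_smul_div_atTop {Y : Type*} [NormedAddCommGroup Y] [NormedSpace ℝ Y] {C : ℝ}
    (f : X → Y) (a : X → Y) (ha : ∀ (n : ℕ) x, a ((n : ℝ) • x) = (n : ℝ) • a x)
    (h : ∀ x, ‖f x - a x‖ ≤ C) (x : X) :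
    Tendsto (fun n : ℕ => (n : ℝ)⁻¹ • f ((n : ℝ) • x)) atTop (𝓝 (a x)) := by
  rw [tendsto_iff_norm_sub_tendsto_zero]
  refine squeeze_zero' (Eventually.of_forall fun _ => norm_nonneg _) (g := fun n : ℕ => C / n) ?_
    (tendsto_const_div_atTop_nhds_zero_nat C)
  filter_upwards [eventually_ge_atTop 1] with n hn
  have hn' : (0 : ℝ) < n := by exact_mod_cast hn
  have : (n : ℝ)⁻¹ • f ((n : ℝ) • x) - a x = (n : ℝ)⁻¹ • (f ((n : ℝ) • x) - a ((n : ℝ) • x)) := by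
    rw [ha, smul_sub, inv_smul_smul₀ hn'.ne']
  rw [this, norm_smul, norm_inv, Real.norm_natCast, div_eq_inv_mul]
  exact mul_le_mul_of_nonneg_left (h _) (by positivity)

theorem IsUniversallyLeftStable.isCardinalityInjective (h : IsUniversallyLeftStable X) :
    IsCardinalityInjective X := by
  intro Y _ _ j hcard
  obtain ⟨σ⟩ := Cardinal.eq.1 hcard
  classical
  let g : X → Y := fun x => if ‖σ.symm x‖ ≤ 1 then σ.symm x else 0
  have hg : ∀ x, ‖g x‖ ≤ 1 := fun x => by
    by_cases hx : ‖σ.symm x‖ ≤ 1 <;> simp [g, hx]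
  have hgs : ∀ y : Y, ‖y‖ ≤ 1 → ∃ x, g x = y := fun y hy => ⟨σ y, by simp [g, hy]⟩
  -- Stability concerns Banach targets, while `Y` may be incomplete.
  let κ : Y →ₗᵢ[ℝ] UniformSpace.Completion Y := UniformSpace.Completion.toComplₗᵢ
  let f : X → UniformSpace.Completion Y := fun x => κ (j x + (g x - g 0))
  have hgd : ∀ x y, ‖g x - g y‖ ≤ 2 := fun x y => by
    linarith [norm_sub_le (g x) (g y), hg x, hg y]
  have hf : IsStandardEpsIsometry 2 f := by
    refine ⟨fun x y => ?_, by simp [f]⟩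
    have h1 : f x - f y = κ (j (x - y) + (g x - g y)) := by
      simp only [f, ← map_sub]
      congr 1
      rw [map_sub]
      abel
    rw [h1, κ.norm_map, ← j.norm_map (x - y)]
    refine (abs_norm_sub_norm_le _ _).trans ?_
    simpa using hgd x y
  obtain ⟨α, γ, -, -, T, -, hT⟩ := h (UniformSpace.Completion Y) 2 zero_le_two f hf
  let L := closedSpanRange f
  have hLc : IsClosed (L : Set (UniformSpace.Completion Y)) :=
    Submodule.isClosed_topologicalClosure _
  have hlim : ∀ x, Tendsto (fun n : ℕ => (n : ℝ)⁻¹ • f ((n : ℝ) • x)) atTop (𝓝 (κ (j x))) :=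
    tendsto_smul_div_atTop (C := 2) f (fun x => κ (j x)) (fun n x => by simp) fun x => by
      have : f x - κ (j x) = κ (g x - g 0) := by simp only [f, ← map_sub]; congr 1; abel
      rw [this, κ.norm_map]
      exact hgd x 0
  have hjL : ∀ x, κ (j x) ∈ L := fun x => hLc.mem_of_tendsto (hlim x)
    (Eventually.of_forall fun n => L.smul_mem _ (mem_closedSpanRange f _))
  -- Rescaling by `n` divides the bounded error of `T ∘ f` by `n`, so `T` inverts `κ ∘ j` exactly.
  have hTj : ∀ x, T ⟨κ (j x), hjL x⟩ = x := fun x => by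
    have h1 : Tendsto (fun n : ℕ => (n : ℝ)⁻¹ • (⟨f ((n : ℝ) • x), mem_closedSpanRange f _⟩ : L))
        atTop (𝓝 ⟨κ (j x), hjL x⟩) := tendsto_subtype_rng.2 (hlim x)
    have h2 := (T.continuous.tendsto _).comp h1
    have h3 := tendsto_smul_div_atTop (fun x => T ⟨f x, mem_closedSpanRange f x⟩) id
      (fun _ _ => rfl) hT x
    exact tendsto_nhds_unique h2 (h3.congr fun n => (map_smul T _ _).symm)
  have hgL : ∀ x, κ (g x - g 0) ∈ L := fun x => by
    have : κ (g x - g 0) = f x - κ (j x) := by simp only [f, ← map_sub]; congr 1; abel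
    rw [this]
    exact sub_mem (mem_closedSpanRange f x) (hjL x)
  have hball : ∀ y : Y, ‖y‖ ≤ 1 → κ y ∈ L := fun y hy => by
    obtain ⟨x, rfl⟩ := hgs y hy
    obtain ⟨w, hw⟩ := hgs 0 (by simp)
    -- A zero `w` of `g` removes the shift `g 0` that was needed for `f 0 = 0`.
    have : κ (g x) = κ (g x - g 0) - κ (g w - g 0) := by rw [← map_sub]; congr 1; simp [hw]
    rw [this]
    exact sub_mem (hgL x) (hgL w)
  have hκL : ∀ y : Y, κ y ∈ L := fun y => by
    have h1 : y = (1 + ‖y‖) • ((1 + ‖y‖)⁻¹ • y) := by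
      rw [smul_inv_smul₀ (by positivity)]
    rw [h1, map_smul]
    refine L.smul_mem _ (hball _ ?_)
    rw [norm_smul, norm_inv, Real.norm_of_nonneg (by positivity), inv_mul_le_one₀ (by positivity)]
    linarith
  let P : Y →L[ℝ] X := T.comp
    (κ.toContinuousLinearMap.codRestrict L hκL)
  have hP : ∀ x, P (j x) = x := hTj
  refine ⟨(j.toContinuousLinearMap.comp P).codRestrict _ fun y => ⟨P y, rfl⟩, ?_⟩
  rintro ⟨_, x, rfl⟩
  apply Subtype.ext
  exact congrArg j (hP x)

/-- An `ε`-isometry of a line is linearised up to `3 * ε` by a functional. -/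
theorem IsStandardEpsIsometry.exists_functional_line {Y : Type*} [NormedAddCommGroup Y]
    [NormedSpace ℝ Y] {ε : ℝ} {f : X → Y} (hf : IsStandardEpsIsometry ε f) (x : X) :
    ∃ φ : StrongDual ℝ Y, ‖φ‖ ≤ 1 ∧ ∀ t : ℝ, |φ (f (t • x)) - t * ‖x‖| ≤ 3 * ε := by
  obtain ⟨hf, hf0⟩ := hf
  choose φ hφn hφ using fun n : ℕ =>
    exists_dual_vector'' ℝ (f ((n : ℝ) • x) - f (-(n : ℝ) • x))
  let U : Ultrafilter ℕ := Ultrafilter.of atTop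
  have hU : (U : Filter ℕ) ≤ atTop := Ultrafilter.of_le _
  obtain ⟨ψ, hψn, hψ⟩ := exists_strongDual_tendsto U (fun n y => φ n y) zero_le_one
    (fun y => Eventually.of_forall fun n => (φ n).le_of_opNorm_le (hφn n) y)
    (fun y z => Eventually.of_forall fun n => map_add _ _ _)
    (fun c y => Eventually.of_forall fun n => by simp)
  refine ⟨ψ, hψn, fun t => ?_⟩
  refine le_of_tendsto ((hψ (f (t • x))).sub_const (t * ‖x‖)).abs (hU ?_)
  obtain ⟨N, hN⟩ := exists_nat_ge |t|
  filter_upwards [eventually_ge_atTop N] with n hn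
  have hn' : |t| ≤ n := hN.trans (by exact_mod_cast hn)
  obtain ⟨ht1, ht2⟩ := abs_le.1 hn'
  -- Increments exceed the linear rate by at most `ε`, yet the total over `[-n, n]` falls short by
  -- at most `ε`. Anchoring at `0` and comparing with `t` gives `3ε`.
  have hle : ∀ a b : ℝ, b ≤ a → φ n (f (a • x)) - φ n (f (b • x)) ≤ (a - b) * ‖x‖ + ε := by
    intro a b hab
    have h1 : φ n (f (a • x) - f (b • x)) ≤ ‖f (a • x) - f (b • x)‖ :=
      (le_abs_self _).trans (by simpa using (φ n).le_of_opNorm_le (hφn n) (f (a • x) - f (b • x)))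
    have h2 := (abs_le.1 (hf (a • x) (b • x))).2
    rw [← sub_smul, norm_smul, Real.norm_of_nonneg (sub_nonneg.2 hab)] at h2
    rw [map_sub] at h1
    linarith
  have hnn : (0 : ℝ) ≤ n := n.cast_nonneg
  have htop : φ n (f ((n : ℝ) • x)) - φ n (f (-(n : ℝ) • x)) ≥ 2 * n * ‖x‖ - ε := by
    have h1 := hφ n
    have h2 := (abs_le.1 (hf ((n : ℝ) • x) (-(n : ℝ) • x))).1
    rw [← sub_smul, norm_smul, Real.norm_of_nonneg (by linarith)] at h2
    rw [map_sub] at h1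
    simp only [RCLike.ofReal_real_eq_id, id_eq] at h1
    nlinarith
  have h0 : φ n (f ((0 : ℝ) • x)) = 0 := by simp [hf0]
  have a1 := hle n 0 hnn
  have a2 := hle 0 (-n) (by linarith)
  have a3 := hle n t ht2
  have a4 := hle t (-n) ht1
  rw [abs_le]
  constructor <;> linarith

/-- Asymptotics of the norm along a ray in a direction where the norm is differentiable. -/
theorem tendsto_norm_smul_sub_sub {x : X} {D : StrongDual ℝ X}
    (hD : HasFDerivAt (fun y : X => ‖y‖) D x) (y : X) :
    Tendsto (fun t : ℝ => ‖t • x - y‖ - t * ‖x‖) atTop (𝓝 (-D y)) := by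
  rw [← map_neg]
  refine (hD.lim_real (-y)).congr' ?_
  filter_upwards [eventually_gt_atTop 0] with t ht
  have h1 : t • x - y = t • (x + t⁻¹ • -y) := by
    rw [smul_add, smul_inv_smul₀ ht.ne', sub_eq_add_neg]
  rw [h1, norm_smul, Real.norm_of_nonneg ht.le, smul_eq_mul, mul_sub]

/-- The derivative of the norm at a point is transported by an `ε`-isometry, up to `4 * ε`, to a
functional on the target. -/
theorem IsStandardEpsIsometry.exists_functional_of_hasFDerivAt {Y : Type*} [NormedAddCommGroup Y]
    [NormedSpace ℝ Y] {ε : ℝ} {f : X → Y} (hf : IsStandardEpsIsometry ε f) {x : X}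
    {D : StrongDual ℝ X} (hD : HasFDerivAt (fun y : X => ‖y‖) D x) :
    ∃ φ : StrongDual ℝ Y, ‖φ‖ ≤ 1 ∧ ∀ y, |φ (f y) - D y| ≤ 4 * ε := by
  obtain ⟨φ, hφn, hφ⟩ := hf.exists_functional_line x
  have hle : ∀ y z, φ (f y) - φ (f z) ≤ ‖y - z‖ + ε := fun y z => by
    have h1 : φ (f y - f z) ≤ ‖f y - f z‖ :=
      (le_abs_self _).trans (by simpa using φ.le_of_opNorm_le hφn (f y - f z))
    have h2 := (abs_le.1 (hf.1 y z)).2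
    rw [map_sub] at h1
    linarith
  -- The error is `3ε` along the line plus `ε` for one increment; the two bounds use the two ends of
  -- the line.
  refine ⟨φ, hφn, fun y => abs_le.2 ⟨?_, ?_⟩⟩
  · have := ge_of_tendsto' (tendsto_norm_smul_sub_sub hD y) (b := -φ (f y) - 4 * ε) fun t => by
      have h1 := hle (t • x) y
      have h2 := (abs_le.1 (hφ t)).1
      linarith
    linarith
  · have := ge_of_tendsto' (tendsto_norm_smul_sub_sub hD (-y)) (b := φ (f y) - 4 * ε) fun t => by
      have h1 := hle y (-t • x)
      have h2 := (abs_le.1 (hφ (-t))).2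
      have h3 : y - -t • x = t • x - -y := by rw [neg_smul]; abel
      rw [h3] at h1
      linarith
    rw [map_neg, neg_neg] at this
    linarith

/-- The derivatives of the norm of a finite-dimensional space form a norming set. -/
theorem exists_linearIsometry_fderiv_norm (G : Type*) [NormedAddCommGroup G] [NormedSpace ℝ G]
    [FiniteDimensional ℝ G] :
    ∃ J : G →ₗᵢ[ℝ] lp (fun _ : {x : G // DifferentiableAt ℝ (fun y : G => ‖y‖) x} => ℝ) ∞,
      ∀ y γ, J y γ = fderiv ℝ (fun y : G => ‖y‖) γ.1 y := by
  have hn : ∀ x : G, ‖fderiv ℝ (fun y : G => ‖y‖) x‖ ≤ 1 := fun x => by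
    simpa using norm_fderiv_le_of_lipschitz ℝ (lipschitzWith_one_norm (E := G)) (x₀ := x)
  obtain ⟨Φ, hΦn, hΦ⟩ := exists_clm_lp_infty
    (fun γ : {x : G // DifferentiableAt ℝ (fun y : G => ‖y‖) x} =>
      fderiv ℝ (fun y : G => ‖y‖) γ.1) zero_le_one fun γ => hn γ.1
  refine ⟨⟨Φ.toLinearMap, fun y => le_antisymm ?_ ?_⟩, hΦ⟩
  · simpa using Φ.le_of_opNorm_le hΦn y
  · borelize G
    -- By Rademacher's theorem some `x` near `y` is a differentiability point; the derivative there
    -- equals `‖x‖` at `x`, hence is almost `‖y‖` at `y`.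
    have hdense : Dense {x : G | DifferentiableAt ℝ (fun y : G => ‖y‖) x} :=
      MeasureTheory.Measure.dense_of_ae (μ := MeasureTheory.Measure.addHaar)
        (lipschitzWith_one_norm (E := G)).ae_differentiableAt
    refine le_of_forall_pos_le_add fun δ hδ => ?_
    obtain ⟨x, hx, hxy⟩ := hdense.exists_dist_lt y (half_pos hδ)
    rw [dist_eq_norm] at hxy
    have h1 := lp.norm_apply_le_norm ENNReal.top_ne_zero (Φ y) ⟨x, hx⟩
    rw [hΦ] at h1
    have h2 : fderiv ℝ (fun y : G => ‖y‖) x x = ‖x‖ := hx.fderiv_norm_self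
    have h3 : ‖fderiv ℝ (fun y : G => ‖y‖) x (x - y)‖ ≤ ‖y - x‖ := by
      simpa [norm_sub_rev] using ContinuousLinearMap.le_of_opNorm_le _ (hn x) (x - y)
    rw [map_sub, h2] at h3
    have h4 := (le_abs_self _).trans h3
    have h5 := (le_abs_self _).trans h1
    have h6 := norm_sub_norm_le y x
    simp only [ContinuousLinearMap.coe_coe] at *
    linarith

/-- On a finite-dimensional subspace an `ε`-isometry into any space is approximately inverted by
an operator into an injective space. -/
theorem IsInjectiveWith.exists_approx_inverse {lam : ℝ} (h : IsInjectiveWith X lam)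
    (hlam : 0 ≤ lam) {Y : Type*} [NormedAddCommGroup Y] [NormedSpace ℝ Y] {ε : ℝ} (hε : 0 ≤ ε)
    {f : X → Y} (hf : IsStandardEpsIsometry ε f) (G : Submodule ℝ X) [FiniteDimensional ℝ G] :
    ∃ S : Y →L[ℝ] X, ‖S‖ ≤ lam ∧ ∀ x ∈ G, ‖S (f x) - x‖ ≤ lam * (4 * ε) := by
  have : CompleteSpace G := FiniteDimensional.complete ℝ G
  have hfG : IsStandardEpsIsometry ε fun x : G => f x := ⟨fun x y => hf.1 x y, hf.2⟩
  obtain ⟨J, hJ⟩ := exists_linearIsometry_fderiv_norm G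
  choose φ hφn hφ using fun γ : {x : G // DifferentiableAt ℝ (fun y : G => ‖y‖) x} =>
    hfG.exists_functional_of_hasFDerivAt γ.2.hasFDerivAt
  obtain ⟨Φ, hΦn, hΦ⟩ := exists_clm_lp_infty φ zero_le_one hφn
  -- `S` extends the inclusion of `G` along `J`; on `G`, `Φ ∘ f` is within `4ε` of `J` in sup norm.
  obtain ⟨S, hS, hSn⟩ := h.exists_comp_eq hlam J G.subtypeL
  have hSn' : ‖S‖ ≤ lam := hSn.trans (mul_le_of_le_one_right hlam G.norm_subtypeL_le)
  refine ⟨S.comp Φ, (S.opNorm_comp_le Φ).trans ?_, fun x hx => ?_⟩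
  · exact (mul_le_of_le_one_right (norm_nonneg S) hΦn).trans hSn'
  · have h1 : S.comp Φ (f x) - x = S (Φ (f x) - J ⟨x, hx⟩) := by
      rw [map_sub, hS]; rfl
    rw [h1]
    refine (S.le_of_opNorm_le hSn' _).trans (mul_le_mul_of_nonneg_left ?_ hlam)
    refine lp.norm_le_of_forall_le (by positivity) fun γ => ?_
    rw [lp.coeFn_sub, Pi.sub_apply, hΦ, hJ]
    exact hφ γ ⟨x, hx⟩

/-- The approximate inverses have bounds independent of the finite-dimensional subspace, so they
survive the weak-star limit. -/
theorem IsInjectiveSpace.isUniversallyLeftStable {M : Type*} [NormedAddCommGroup M]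
    [NormedSpace ℝ M] (e : X ≃L[ℝ] StrongDual ℝ M) (h : IsInjectiveSpace X) :
    IsUniversallyLeftStable X := by
  obtain ⟨lam, hlam, h⟩ := h
  have hlam0 : 0 ≤ lam := zero_le_one.trans hlam
  intro Y _ _ _ ε hε f hf
  choose S hSn hS using fun s : Finset X =>
    have : FiniteDimensional ℝ (Submodule.span ℝ (s : Set X)) := FiniteDimensional.span_finset ℝ s
    h.exists_approx_inverse hlam0 hε hf (Submodule.span ℝ (s : Set X))
  let U : Ultrafilter (Finset X) := Ultrafilter.of atTop
  have hU : (U : Filter (Finset X)) ≤ atTop := Ultrafilter.of_le _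
  obtain ⟨T, hT⟩ := exists_clm_ultrafilter_limit e U (fun s y => S s y) hlam0
    (fun y => Eventually.of_forall fun s => (S s).le_of_opNorm_le (hSn s) y)
    (fun y z => Eventually.of_forall fun s => map_add _ _ _)
    (fun c y => Eventually.of_forall fun s => map_smul _ _ _)
  set K := ‖(e.symm : StrongDual ℝ M →L[ℝ] X)‖
  set K' := ‖(e : X →L[ℝ] StrongDual ℝ M)‖
  let R : closedSpanRange f →L[ℝ] X := T.comp (closedSpanRange f).subtypeL
  refine ⟨‖R‖ + 1, K * (K' * (lam * 4)) + 1, by positivity, by positivity, R, by linarith,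
    fun x => ?_⟩
  have h1 := hT (f x) x (lam * (4 * ε)) (by positivity) (hU <| by
    refine (eventually_ge_atTop {x}).mono fun s hs => hS s x (Submodule.subset_span ?_)
    exact hs (Finset.mem_singleton_self x))
  have h2 : ‖R ⟨f x, mem_closedSpanRange f x⟩ - x‖ ≤ K * (K' * (lam * (4 * ε))) := h1
  linarith

end LeftStability

end StableEmbedding

theorem corollary3p14 {X : Type u} [NormedAddCommGroup X] [NormedSpace ℝ X] [CompleteSpace X]
    {M : Type v} [NormedAddCommGroup M] [NormedSpace ℝ M]
    (e : X ≃L[ℝ] StrongDual ℝ M) :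
    (StableEmbedding.IsSeparablyInjective X ↔ StableEmbedding.IsUniversallyLeftStable X) ∧
    List.TFAE [StableEmbedding.IsCardinalityInjective X,
      StableEmbedding.IsSeparablyInjective X,
      StableEmbedding.IsInjectiveSpace X,
      StableEmbedding.IsUniversallyLeftStable X] := by
  obtain ⟨j, -⟩ := StableEmbedding.exists_linearIsometry_lp_infty X
  have injective_of_local : StableEmbedding.IsLocallyComplemented j →
      StableEmbedding.IsInjectiveSpace X := fun h => by
    obtain ⟨P, hP⟩ := h.exists_retraction e
    exact StableEmbedding.isInjectiveSpace_of_retract j P hP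
  have separably_of_injective : StableEmbedding.IsInjectiveSpace X →
      StableEmbedding.IsSeparablyInjective X := fun ⟨lam, hlam, h⟩ =>
    ⟨lam, hlam, fun E _ _ _ _ F hF T => h E F hF T⟩
  have tfae : List.TFAE [StableEmbedding.IsCardinalityInjective X,
      StableEmbedding.IsSeparablyInjective X,
      StableEmbedding.IsInjectiveSpace X,
      StableEmbedding.IsUniversallyLeftStable X] := by
    tfae_have 1 → 2 := fun h => separably_of_injective (injective_of_local
      (h.isLocallyComplemented j))
    tfae_have 2 → 3 := fun h => injective_of_local (h.isLocallyComplemented j)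
    tfae_have 3 → 4 := fun h => h.isUniversallyLeftStable e
    tfae_have 4 → 1 := fun h => h.isCardinalityInjective
    tfae_finish
  exact ⟨tfae.out 1 3, tfae⟩
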